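/- \textbf{Setting.} Let $\mathcal X\subset\mathbb R^p$ be a compact set. Let the original feature $X$ and the synthetic feature $\widetilde X$ have probability densities $\mathbb P_X$ and $\mathbb P_{\widetilde X}$ with respect to Lebesgue measure, both vanishing outside $\mathcal X$. Let $\beta^*\in\mathbb R^p$ and let $B$ be a constant with $\|\beta^*\|_\infty<B/2$. For $\beta\in\mathbb R^p$ put $\eta_\beta(x)=1/(1+\exp(-x^T\beta))$. The original data set $\mathcal D_n=\{(x_i,z_i)\}_{i=1}^n$ is an i.i.d. sample of $(X,Z)$, where $Z\in\{-1,1\}$ and $\mathbb P(Z=1\mid X=x)=\eta_{\beta^*}(x)$. Let $$\widehat\beta\in\mathop{\mathrm{argmin}}_{\beta\in\mathbb R^p}\frac1n\sum_{i=1}^n\log\bigl(1+\exp(-z_ix_i^T\beta)\bigr)$$ be the maximum likelihood estimator computed from $\mathcal D_n$; on data sets for which no minimizer exists, $\widehat\beta$ may take any (measurable) value. Conditionally on $\mathcal D_n$, the synthetic data set $\widetilde{\mathcal D}=\{(\widetilde x_j,\widetilde z_j)\}_{j=1}^{\widetilde n}$ consists of i.i.d. pairs with $\widetilde x_j$ distributed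 as $\widetilde X$ and $\widetilde z_j\in\{-1,1\}$, $\mathbb P(\widetilde z_j=1\mid \widetilde x_j)=\eta_{\widehat\beta}(\widetilde x_j)$. Let $\mathcal G=\{x\mapsto x^T\beta:\beta\in[-B,B]^p\}$ and let $$\widehat g_{\log}\in\mathop{\mathrm{argmin}}_{g\in\mathcal G}\frac1n\sum_{i=1}^n\log\bigl(1+\exp(-z_ig(x_i))\bigr),\qquad \widetilde g_{\log}\in\mathop{\mathrm{argmin}}_{g\in\mathcal G}\frac1{\widetilde n}\sum_{j=1}^{\widetilde n}\log\bigl(1+\exp(-\widetilde z_jg(\widetilde x_j))\bigr).$$ Write $R_{0\text{-}1}(g)=\mathbb P(\mathrm{sign}(g(X))\neq Z)$ (with $\mathrm{sign}(0)=0$) and $U_c(\widetilde g,\widehat g)=|R_{0\text{-}1}(\widetilde g)-R_{0\text{-}1}(\widehat g)|$. \textbf{Theorem.} Suppose that there is a constant $C_1>0$ with $\mathbb P_{\widetilde X}(x)\le C_1\,\mathbb P_X(x)$ for all $x\in\mathcal X$. Then for every $\delta>0$, $$\lim_{n\to\infty}\ \limsup_{\widetilde n\to\infty}\ \mathbb P\bigl(U_c(\widetilde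 g_{\log},\widehat g_{\log})>\delta\bigr)=0 .$$ In particular, $\lim_{n\to\infty}\lim_{\widetilde n\to\infty}\mathbb P(U_c(\widetilde g_{\log},\widehat g_{\log})>\delta)=0$ whenever the inner limits exist. The distributions of $X$ and $\widetilde X$ are not required to agree. -/

import Mathlib

open MeasureTheory ProbabilityTheory Filter Topology
open scoped ENNReal Matrix

/-- A feature vector in `ℝ^p`; the norm `‖·‖` on this type is the sup norm. -/
abbrev Feature (p : ℕ) : Type := Fin p → ℝ

/-- A labelled sample `(x, z)`; all laws below are concentrated on labels `z ∈ {-1, 1}`. -/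
abbrev Sample (p : ℕ) : Type := Feature p × ℝ

/-- A data set of `n` labelled samples. -/
abbrev Dataset (p n : ℕ) : Type := Fin n → Sample p

/-- `f` is a probability density function of `μ` with respect to Lebesgue measure, and it
vanishes outside `𝒳`. -/
structure HasDensityOn {p : ℕ} (μ : Measure (Feature p)) (𝒳 : Set (Feature p))
    (f : Feature p → ℝ) : Prop where
  measurable : Measurable f
  nonneg : ∀ x, 0 ≤ f x
  eq_zero_of_notMem : ∀ x, x ∉ 𝒳 → f x = 0
  eq_withDensity : μ = volume.withDensity fun x => ENNReal.ofReal (f x)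

/-- The logistic regression function `η_β(x) = 1 / (1 + exp(-xᵀβ))`. -/
noncomputable def logisticProb {p : ℕ} (β x : Feature p) : ℝ :=
  1 / (1 + Real.exp (-(x ⬝ᵥ β)))

/-- The law of `(X, Z)` where `X ∼ μ` and, given `X = x`, `Z = 1` with probability `η_β(x)` and
`Z = -1` with probability `1 - η_β(x)`. -/
noncomputable def logisticLaw {p : ℕ} (μ : Measure (Feature p)) (β : Feature p) :
    Measure (Sample p) :=
  (μ.withDensity fun x => ENNReal.ofReal (logisticProb β x)).map (fun x => (x, (1 : ℝ))) +
    (μ.withDensity fun x => ENNReal.ofReal (1 - logisticProb β x)).map (fun x => (x, (-1 : ℝ)))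

/-- The law of `n` independent samples from `Q`. -/
noncomputable def iidLaw {p : ℕ} (Q : Measure (Sample p)) (n : ℕ) : Measure (Dataset p n) :=
  Measure.pi fun _ => Q

/-- The empirical logistic risk `(1/n) ∑ᵢ log(1 + exp(-zᵢ g(xᵢ)))`. -/
noncomputable def empLogisticRisk {p n : ℕ} (D : Dataset p n) (g : Feature p → ℝ) : ℝ :=
  (1 / (n : ℝ)) * ∑ i, Real.log (1 + Real.exp (-((D i).2 * g (D i).1)))

/-- The linear function `x ↦ xᵀβ`. -/
def linearScore {p : ℕ} (β : Feature p) : Feature p → ℝ := fun x => x ⬝ᵥ β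

/-- The class `{x ↦ xᵀβ : β ∈ [-B, B]^p}`. -/
def boundedLinearClass (p : ℕ) (B : ℝ) : Set (Feature p → ℝ) :=
  {g | ∃ β : Feature p, (∀ i, β i ∈ Set.Icc (-B) B) ∧ g = linearScore β}

/-- `β` is a maximum likelihood estimate from `D`: a minimizer of the empirical logistic risk over
all of `ℝ^p`. -/
def IsLogisticMLE {p n : ℕ} (D : Dataset p n) (β : Feature p) : Prop :=
  ∀ β' : Feature p, empLogisticRisk D (linearScore β) ≤ empLogisticRisk D (linearScore β')

/-- `g` minimizes the empirical logistic risk over the class `G`. -/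
def IsLogisticERM {p n : ℕ} (G : Set (Feature p → ℝ)) (D : Dataset p n)
    (g : Feature p → ℝ) : Prop :=
  g ∈ G ∧ ∀ h ∈ G, empLogisticRisk D g ≤ empLogisticRisk D h

/-- The 0-1 risk `P(sign(g(X)) ≠ Z)` for `(X, Z) ∼ Q`. -/
noncomputable def zeroOneRisk {p : ℕ} (Q : Measure (Sample p)) (g : Feature p → ℝ) : ℝ :=
  Q.real {q | Real.sign (g q.1) ≠ q.2}

/-- The utility metric `|R₀₁(g̃) - R₀₁(ĝ)|`, with risks taken under `Q`. -/
noncomputable def classUtility {p : ℕ} (Q : Measure (Sample p)) (g₁ g₂ : Feature p → ℝ) : ℝ :=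
  |zeroOneRisk Q g₁ - zeroOneRisk Q g₂|

theorem logisticProb_pos {p : ℕ} (β x : Feature p) : 0 < logisticProb β x := by
  unfold logisticProb; positivity

theorem logisticProb_le_one {p : ℕ} (β x : Feature p) : logisticProb β x ≤ 1 := by
  unfold logisticProb
  rw [div_le_one (by positivity)]
  linarith [Real.exp_pos (-(x ⬝ᵥ β))]

theorem measurable_logisticProb {p : ℕ} :
    Measurable fun q : Feature p × Feature p => logisticProb q.1 q.2 := by
  unfold logisticProb dotProduct
  fun_prop

theorem logisticLaw_apply {p : ℕ} (μ : Measure (Feature p)) (β : Feature p)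
    {s : Set (Sample p)} (hs : MeasurableSet s) :
    logisticLaw μ β s =
      (∫⁻ x, ((fun x => (x, (1 : ℝ))) ⁻¹' s).indicator
          (fun x => ENNReal.ofReal (logisticProb β x)) x ∂μ) +
        ∫⁻ x, ((fun x => (x, (-1 : ℝ))) ⁻¹' s).indicator
          (fun x => ENNReal.ofReal (1 - logisticProb β x)) x ∂μ := by
  have h1 : Measurable fun x : Feature p => (x, (1 : ℝ)) := by fun_prop
  have h2 : Measurable fun x : Feature p => (x, (-1 : ℝ)) := by fun_prop
  rw [logisticLaw, Measure.add_apply, Measure.map_apply h1 hs, Measure.map_apply h2 hs,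
    withDensity_apply _ (h1 hs), withDensity_apply _ (h2 hs), lintegral_indicator (h1 hs),
    lintegral_indicator (h2 hs)]

instance instIsProbabilityMeasureLogisticLaw {p : ℕ} (μ : Measure (Feature p))
    [IsProbabilityMeasure μ] (β : Feature p) :
    IsProbabilityMeasure (logisticLaw μ β) := by
  refine ⟨?_⟩
  have hm : Measurable fun x : Feature p => logisticProb β x := by
    unfold logisticProb dotProduct
    fun_prop
  rw [logisticLaw_apply μ β MeasurableSet.univ]
  simp only [Set.preimage_univ, Set.indicator_univ]
  rw [← lintegral_add_left (by fun_prop)]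
  have : ∀ x, ENNReal.ofReal (logisticProb β x) + ENNReal.ofReal (1 - logisticProb β x) = 1 := by
    intro x
    rw [← ENNReal.ofReal_add (logisticProb_pos β x).le
      (sub_nonneg.2 (logisticProb_le_one β x))]
    simp
  simp [this]

instance instIsProbabilityMeasureIidLaw {p : ℕ} (Q : Measure (Sample p))
    [IsProbabilityMeasure Q] (n : ℕ) :
    IsProbabilityMeasure (iidLaw Q n) := by
  unfold iidLaw; infer_instance

theorem measurable_logisticLaw {p : ℕ} (μ : Measure (Feature p)) [IsProbabilityMeasure μ] :
    Measurable fun β : Feature p => logisticLaw μ β := by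
  refine Measure.measurable_of_measurable_coe _ fun s hs => ?_
  simp only [logisticLaw_apply μ _ hs]
  have key : ∀ (c : ℝ) (F : Feature p × Feature p → ℝ≥0∞), Measurable F →
      Measurable fun β : Feature p =>
        ∫⁻ x, ((fun x => (x, c)) ⁻¹' s).indicator (fun x => F (β, x)) x ∂μ := by
    intro c F hF
    have ht : MeasurableSet ((fun q : Feature p × Feature p => (q.2, c)) ⁻¹' s) :=
      (show Measurable fun q : Feature p × Feature p => (q.2, c) by fun_prop) hs
    exact (hF.indicator ht).lintegral_prod_right'
  exact (key 1 (fun q => ENNReal.ofReal (logisticProb q.1 q.2))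
      measurable_logisticProb.ennreal_ofReal).add
    (key (-1) (fun q => ENNReal.ofReal (1 - logisticProb q.1 q.2))
      (measurable_const.sub measurable_logisticProb).ennreal_ofReal)

theorem measurable_iidLaw_logisticLaw {p : ℕ} (μ : Measure (Feature p))
    [IsProbabilityMeasure μ] (m : ℕ) :
    Measurable fun β : Feature p => iidLaw (logisticLaw μ β) m := by
  refine Measurable.measure_of_isPiSystem_of_isProbabilityMeasure generateFrom_pi.symm
    isPiSystem_pi ?_
  rintro _ ⟨s, hs, rfl⟩
  simp only [iidLaw, Measure.pi_pi]
  exact Finset.measurable_prod _ fun i _ =>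
    (Measure.measurable_coe (show MeasurableSet (s i) from hs i (Set.mem_univ i))).comp (measurable_logisticLaw μ)

/-- The synthetic data generator: given a coefficient vector `β`, it outputs `m` independent
samples `(x̃ⱼ, z̃ⱼ)` with `x̃ⱼ ∼ ν` and `z̃ⱼ = ±1` drawn from the logistic model `η_β(x̃ⱼ)`. -/
noncomputable def syntheticKernel {p : ℕ} (ν : Measure (Feature p)) [IsProbabilityMeasure ν]
    (m : ℕ) : Kernel (Feature p) (Dataset p m) where
  toFun β := iidLaw (logisticLaw ν β) m
  measurable' := measurable_iidLaw_logisticLaw ν m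

instance instIsMarkovKernelSyntheticKernel {p : ℕ} (ν : Measure (Feature p))
    [IsProbabilityMeasure ν] (m : ℕ) :
    IsMarkovKernel (syntheticKernel ν m) :=
  ⟨fun β => inferInstanceAs (IsProbabilityMeasure (iidLaw (logisticLaw ν β) m))⟩

/-- The joint law of the original data set `D` (of size `n`, i.i.d. from the logistic model with
features `μ` and coefficient `βstar`) and the synthetic data set of size `m`, which given `D` is
generated from features `ν` and the fitted coefficient `βhat D`. -/
noncomputable def jointLaw {p : ℕ} (μ ν : Measure (Feature p)) [IsProbabilityMeasure ν]
    (βstar : Feature p) (n m : ℕ) (βhat : Dataset p n → Feature p) (hβ : Measurable βhat) :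
    Measure (Dataset p n × Dataset p m) :=
  iidLaw (logisticLaw μ βstar) n ⊗ₘ (syntheticKernel ν m).comap βhat hβ

instance instIsProbabilityMeasureJointLaw {p : ℕ} (μ ν : Measure (Feature p))
    [IsProbabilityMeasure μ] [IsProbabilityMeasure ν] (βstar : Feature p) (n m : ℕ)
    (βhat : Dataset p n → Feature p) (hβ : Measurable βhat) :
    IsProbabilityMeasure (jointLaw μ ν βstar n m βhat hβ) := by
  unfold jointLaw; infer_instance

/-!
A data set on which the empirical logistic risk is larger on a sphere around a point `c` than at
`c` itself has, by convexity, all its maximum likelihood estimates and constrained minimizers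
inside that sphere. If the features have an absolutely continuous law, then the population
logistic risk is uniquely minimized by the true coefficient `c`, and the gap between its values at
`c` and on the sphere persists when the data are generated with a coefficient close to `c`.
A uniform law of large numbers turns this into a bound `C / n` for the probability of the bad data
sets of size `n`, uniformly in the generating coefficient near `c`.

With `c` the true coefficient, the maximum likelihood estimate from the original data is therefore
close enough to `c` for the synthetic data to localize around the same `c`, and both classifiers
have coefficients close to `c`. If `c ≠ 0`, the 0-1 risk of linear classifiers is continuous at
`c`, so the two risks are close. If `c = 0`, the 0-1 risk is `1 / 2` for all nonzero linear
classifiers, and almost surely neither data set makes the zero classifier a minimizer.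
-/

/-! ### The logistic loss -/

/-- The logistic loss `log (1 + exp (-u))` of the margin `u`. -/
noncomputable def logisticLoss (u : ℝ) : ℝ := Real.log (1 + Real.exp (-u))

theorem logisticLoss_neg (u : ℝ) : logisticLoss (-u) = logisticLoss u + u := by
  have h : 1 + Real.exp u = (1 + Real.exp (-u)) * Real.exp u := by
    rw [add_mul, ← Real.exp_add]
    simp [add_comm]
  rw [logisticLoss, neg_neg, h, Real.log_mul (by positivity) (by positivity), Real.log_exp,
    logisticLoss]

theorem hasDerivAt_logisticLoss (u : ℝ) : HasDerivAt logisticLoss (-Real.sigmoid (-u)) u := by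
  refine ((((hasDerivAt_neg u).exp).const_add 1).log (by positivity)).congr_deriv ?_
  rw [Real.sigmoid_def, neg_neg, Real.exp_neg]
  field_simp
  ring

theorem continuous_logisticLoss : Continuous logisticLoss :=
  continuous_iff_continuousAt.2 fun u => (hasDerivAt_logisticLoss u).continuousAt

theorem strictConvexOn_logisticLoss : StrictConvexOn ℝ Set.univ logisticLoss := by
  refine StrictMono.strictConvexOn_univ_of_deriv continuous_logisticLoss fun u v huv => ?_
  rw [(hasDerivAt_logisticLoss u).deriv, (hasDerivAt_logisticLoss v).deriv]
  exact neg_lt_neg (Real.sigmoid_strictMono (neg_lt_neg huv))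

theorem logisticLoss_tangent_lt {s t : ℝ} (h : s ≠ t) :
    logisticLoss s - Real.sigmoid (-s) * (t - s) < logisticLoss t := by
  rcases h.lt_or_gt with h | h
  · have := strictConvexOn_logisticLoss.lt_slope_of_hasDerivAt (Set.mem_univ s) (Set.mem_univ t) h
      (hasDerivAt_logisticLoss s)
    rw [slope_def_field, lt_div_iff₀ (sub_pos.2 h)] at this
    linarith
  · have := strictConvexOn_logisticLoss.slope_lt_of_hasDerivAt (Set.mem_univ t) (Set.mem_univ s) h
      (hasDerivAt_logisticLoss s)
    rw [slope_def_field, div_lt_iff₀ (sub_pos.2 h)] at this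
    linarith

theorem abs_logisticLoss_sub_le (u v : ℝ) : |logisticLoss u - logisticLoss v| ≤ |u - v| := by
  have h : LipschitzWith 1 logisticLoss := by
    refine lipschitzWith_of_nnnorm_deriv_le
      (fun u => (hasDerivAt_logisticLoss u).differentiableAt) fun u => ?_
    rw [(hasDerivAt_logisticLoss u).deriv, nnnorm_neg, ← NNReal.coe_le_coe, coe_nnnorm,
      Real.norm_of_nonneg (Real.sigmoid_nonneg _)]
    exact Real.sigmoid_le_one _
  simpa [Real.dist_eq] using h.dist_le_mul u v

theorem abs_logisticLoss_le (u : ℝ) : |logisticLoss u| ≤ Real.log 2 + |u| := by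
  have h := abs_logisticLoss_sub_le u 0
  have h0 : logisticLoss 0 = Real.log 2 := by norm_num [logisticLoss]
  rw [h0, sub_zero] at h
  have h2 : |Real.log 2| = Real.log 2 := abs_of_pos (Real.log_pos one_lt_two)
  linarith [abs_sub_abs_le_abs_sub (logisticLoss u) (Real.log 2)]

/-! ### A uniform law of large numbers -/

section EmpiricalMean

variable {α : Type*} [MeasurableSpace α] {Q : Measure α} {m : ℕ}

/-- The deviation of the mean of `φ` over the sample `D` from its expectation under `Q`. -/
noncomputable def empDeviation (Q : Measure α) (φ : α → ℝ) (D : Fin m → α) : ℝ :=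
  1 / (m : ℝ) * ∑ i, φ (D i) - ∫ q, φ q ∂Q

theorem pi_le_abs_empDeviation_le [IsProbabilityMeasure Q] {φ : α → ℝ} (hφ : MemLp φ 2 Q)
    (hm : 0 < m) {ε : ℝ} (hε : 0 < ε) :
    Measure.pi (fun _ : Fin m => Q) {D | ε ≤ |empDeviation Q φ D|} ≤
      ENNReal.ofReal ((∫ q, φ q ^ 2 ∂Q) / ε ^ 2 / m) := by
  set P := Measure.pi fun _ : Fin m => Q
  have hm' : (0 : ℝ) < m := Nat.cast_pos.2 hm
  have hmp : ∀ i, MeasurePreserving (fun D : Fin m → α => D i) P Q :=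
    fun i => measurePreserving_eval (fun _ => Q) i
  have hLp : ∀ i ∈ Finset.univ, MemLp (fun D : Fin m → α => φ (D i)) 2 P :=
    fun i _ => hφ.comp_measurePreserving (hmp i)
  have hvar : Var[∑ i, fun D : Fin m → α => φ (D i); P] ≤ m * ∫ q, φ q ^ 2 ∂Q := by
    rw [variance_sum_pi (X := fun _ => φ) fun _ => hφ]
    have := variance_le_expectation_sq hφ.aestronglyMeasurable
    simpa using mul_le_mul_of_nonneg_left this hm'.le
  have hmean : ∫ D, (∑ i, fun D : Fin m → α => φ (D i)) D ∂P = m * ∫ q, φ q ∂Q := by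
    simp only [Finset.sum_apply]
    rw [integral_finsetSum _ fun i hi => (hLp i hi).integrable (by norm_num)]
    have hcoord : ∀ i, ∫ D, φ (D i) ∂P = ∫ q, φ q ∂Q := fun i =>
      integral_comp_eval (μ := fun _ => Q) (i := i) hφ.aestronglyMeasurable
    simp [hcoord]
  have chebyshev := meas_ge_le_variance_div_sq (memLp_finsetSum' _ hLp) (mul_pos hm' hε)
  rw [hmean] at chebyshev
  refine (measure_mono fun D hD => ?_).trans
    (chebyshev.trans (ENNReal.ofReal_le_ofReal ?_))
  · have hD' : ∑ i, φ (D i) - m * ∫ q, φ q ∂Q = m * empDeviation Q φ D := by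
      rw [empDeviation]
      field_simp
    simp only [Set.mem_ofPred_eq, Finset.sum_apply] at hD ⊢
    rw [hD', abs_mul, abs_of_pos hm']
    gcongr
  · calc _ ≤ m * (∫ q, φ q ^ 2 ∂Q) / (m * ε) ^ 2 := by gcongr
      _ = (∫ q, φ q ^ 2 ∂Q) / ε ^ 2 / m := by field_simp

theorem abs_empDeviation_sub_le {φ ψ G : α → ℝ} (hφ : Integrable φ Q) (hψ : Integrable ψ Q)
    (hG : Integrable G Q) {d : ℝ} {D : Fin m → α}
    (hD : ∀ i, |φ (D i) - ψ (D i)| ≤ G (D i) * d) (hQ : ∀ᵐ q ∂Q, |φ q - ψ q| ≤ G q * d) :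
    |empDeviation Q φ D - empDeviation Q ψ D| ≤ (empDeviation Q G D + 2 * ∫ q, G q ∂Q) * d := by
  have hsum : |1 / (m : ℝ) * ∑ i, (φ (D i) - ψ (D i))| ≤ 1 / (m : ℝ) * ∑ i, G (D i) * d := by
    rw [abs_mul, abs_of_nonneg (by positivity)]
    gcongr
    exact (Finset.abs_sum_le_sum_abs _ _).trans (Finset.sum_le_sum fun i _ => hD i)
  have hint : |∫ q, (φ q - ψ q) ∂Q| ≤ ∫ q, G q * d ∂Q :=
    (Real.norm_eq_abs _).symm.trans_le (norm_integral_le_of_norm_le (hG.mul_const d) hQ)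
  have hsplit : empDeviation Q φ D - empDeviation Q ψ D =
      1 / (m : ℝ) * ∑ i, (φ (D i) - ψ (D i)) - ∫ q, (φ q - ψ q) ∂Q := by
    rw [integral_sub hφ hψ, Finset.sum_sub_distrib, empDeviation, empDeviation]
    ring
  rw [← Finset.sum_mul] at hsum
  rw [integral_mul_const] at hint
  calc |empDeviation Q φ D - empDeviation Q ψ D|
      ≤ 1 / (m : ℝ) * ((∑ i, G (D i)) * d) + (∫ q, G q ∂Q) * d :=
        hsplit ▸ (abs_sub _ _).trans (add_le_add hsum hint)
    _ = (empDeviation Q G D + 2 * ∫ q, G q ∂Q) * d := by rw [empDeviation]; ring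

theorem integral_le_integral_sq_add_one [IsProbabilityMeasure Q] {G : α → ℝ} (hG : MemLp G 2 Q) :
    ∫ q, G q ∂Q ≤ (∫ q, G q ^ 2 ∂Q) + 1 := by
  calc ∫ q, G q ∂Q ≤ ∫ q, (G q ^ 2 + 1) ∂Q :=
        integral_mono (hG.integrable one_le_two) (hG.integrable_sq.add (integrable_const 1))
          fun q => by dsimp only; nlinarith [sq_nonneg (G q - 1)]
    _ = (∫ q, G q ^ 2 ∂Q) + 1 := by
        rw [integral_add hG.integrable_sq (integrable_const 1)]
        simp

/-- A square integrable `G` that, for `Q`-almost every point, bounds every function `f b`, `b ∈ K`,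
and is a Lipschitz constant for the dependence of `f b` on the parameter `b ∈ K`. It is the
hypothesis of the uniform law of large numbers over `K`. -/
structure HasLipschitzEnvelope {β : Type*} [PseudoMetricSpace β] (Q : Measure α) (K : Set β)
    (f : β → α → ℝ) (G : α → ℝ) : Prop where
  memLp : MemLp G 2 Q
  aestronglyMeasurable : ∀ b ∈ K, AEStronglyMeasurable (f b) Q
  abs_le : ∀ᵐ q ∂Q, ∀ b ∈ K, |f b q| ≤ G q
  abs_sub_le : ∀ᵐ q ∂Q, ∀ b ∈ K, ∀ b' ∈ K, |f b q - f b' q| ≤ G q * dist b b'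

namespace HasLipschitzEnvelope

variable {β : Type*} [PseudoMetricSpace β] {K : Set β} {f : β → α → ℝ} {G : α → ℝ}

theorem memLp_of_mem (h : HasLipschitzEnvelope Q K f G) {b : β} (hb : b ∈ K) :
    MemLp (f b) 2 Q :=
  h.memLp.mono' (h.aestronglyMeasurable b hb) (h.abs_le.mono fun _ hq => hq b hb)

theorem integral_sq_le (h : HasLipschitzEnvelope Q K f G) {b : β} (hb : b ∈ K) :
    ∫ q, f b q ^ 2 ∂Q ≤ ∫ q, G q ^ 2 ∂Q :=
  integral_mono_ae (h.memLp_of_mem hb).integrable_sq h.memLp.integrable_sq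
    (h.abs_le.mono fun _ hq => sq_le_sq' (neg_le_of_abs_le (hq b hb)) (le_of_abs_le (hq b hb)))

theorem abs_empDeviation_le_add [IsProbabilityMeasure Q] (h : HasLipschitzEnvelope Q K f G)
    {V : ℝ} (hV : ∫ q, G q ^ 2 ∂Q ≤ V) {b b' : β} (hb : b ∈ K) (hb' : b' ∈ K) {D : Fin m → α}
    (hD : ∀ i, |f b (D i) - f b' (D i)| ≤ G (D i) * dist b b') (hG : empDeviation Q G D ≤ 1) :
    |empDeviation Q (f b) D| ≤ |empDeviation Q (f b') D| + (2 * V + 3) * dist b b' := by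
  have hosc := abs_empDeviation_sub_le ((h.memLp_of_mem hb).integrable one_le_two)
    ((h.memLp_of_mem hb').integrable one_le_two) (h.memLp.integrable one_le_two) hD
    (h.abs_sub_le.mono fun _ hq => hq b hb b' hb')
  have hmean := integral_le_integral_sq_add_one h.memLp
  have : (empDeviation Q G D + 2 * ∫ q, G q ∂Q) * dist b b' ≤ (2 * V + 3) * dist b b' :=
    mul_le_mul_of_nonneg_right (by linarith) dist_nonneg
  linarith [abs_sub_abs_le_abs_sub (empDeviation Q (f b) D) (empDeviation Q (f b') D)]

theorem ae_pi_abs_sub_le [IsProbabilityMeasure Q] (h : HasLipschitzEnvelope Q K f G) (m : ℕ) :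
    ∀ᵐ D ∂Measure.pi fun _ : Fin m => Q, ∀ i, ∀ b ∈ K, ∀ b' ∈ K,
      |f b (D i) - f b' (D i)| ≤ G (D i) * dist b b' :=
  ae_all_iff.2 fun i =>
    (measurePreserving_eval (fun _ => Q) i).quasiMeasurePreserving.ae h.abs_sub_le

/-- The constant depends on the law `Q` only through a bound for the second moment of the
envelope. -/
theorem exists_pi_le_abs_empDeviation_le (hK : TotallyBounded K) (f : β → α → ℝ) {V : ℝ}
    (hV : 0 ≤ V) {ε : ℝ} (hε : 0 < ε) :
    ∃ C : ℝ, ∀ (Q : Measure α) [IsProbabilityMeasure Q] (G : α → ℝ),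
      HasLipschitzEnvelope Q K f G → ∫ q, G q ^ 2 ∂Q ≤ V → ∀ m : ℕ, 0 < m →
        Measure.pi (fun _ : Fin m => Q) {D | ∃ b ∈ K, ε ≤ |empDeviation Q (f b) D|} ≤
          ENNReal.ofReal (C / m) := by
  let ρ := ε / 2 / (2 * V + 3)
  obtain ⟨T, hTK, hT, hKT⟩ := hK.exists_subset (Metric.dist_mem_uniformity (by positivity : 0 < ρ))
  lift T to Finset β using hT
  refine ⟨V + T.card * (V / (ε / 2) ^ 2), fun Q _ G h hGV m hm => ?_⟩
  have hnet : ∀ᵐ D ∂Measure.pi fun _ : Fin m => Q, (∃ b ∈ K, ε ≤ |empDeviation Q (f b) D|) →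
      D ∈ {D | 1 ≤ |empDeviation Q G D|} ∪ ⋃ b ∈ T, {D | ε / 2 ≤ |empDeviation Q (f b) D|} := by
    filter_upwards [h.ae_pi_abs_sub_le m] with D hD
    rintro ⟨b, hbK, hb⟩
    by_contra hsmall
    simp only [Set.mem_union, Set.mem_ofPred_eq, Set.mem_iUnion, not_or, not_le, not_exists]
      at hsmall
    obtain ⟨b', hb'T, hbb'⟩ := Set.mem_iUnion₂.1 (hKT hbK)
    have hosc := h.abs_empDeviation_le_add hGV hbK (hTK hb'T)
      (fun i => hD i b hbK b' (hTK hb'T)) (abs_lt.1 hsmall.1).2.le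
    have hd : (2 * V + 3) * dist b b' ≤ ε / 2 :=
      (le_div_iff₀' (by positivity)).1 (le_of_lt hbb' : dist b b' ≤ ρ)
    linarith [hsmall.2 b' hb'T]
  calc _ ≤ _ := measure_mono_ae hnet
    _ ≤ ENNReal.ofReal (V / 1 ^ 2 / m) + ∑ _b ∈ T, ENNReal.ofReal (V / (ε / 2) ^ 2 / m) := by
        refine (measure_union_le _ _).trans (add_le_add ?_
          ((measure_biUnion_finset_le _ _).trans (Finset.sum_le_sum fun b hb => ?_)))
        · refine (pi_le_abs_empDeviation_le h.memLp hm one_pos).trans ?_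
          gcongr
        · refine (pi_le_abs_empDeviation_le (h.memLp_of_mem (hTK hb)) hm (half_pos hε)).trans ?_
          gcongr
          exact (h.integral_sq_le (hTK hb)).trans hGV
    _ = ENNReal.ofReal ((V + T.card * (V / (ε / 2) ^ 2)) / m) := by
        rw [Finset.sum_const, ← ENNReal.ofReal_nsmul, ← ENNReal.ofReal_add (by positivity)
          (by positivity), nsmul_eq_mul]
        congr 1
        ring

end HasLipschitzEnvelope

end EmpiricalMean

/-! ### Localization of minimizers of convex functions -/

section Convex

variable {E : Type*} [NormedAddCommGroup E] [NormedSpace ℝ E] {F : E → ℝ} {c : E} {r : ℝ}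

theorem mem_ball_of_convexOn_of_lt_on_sphere (hF : ConvexOn ℝ Set.univ F) (hr : 0 < r)
    (hs : ∀ u ∈ Metric.sphere c r, F c < F u) {b : E} (hb : F b ≤ F c) : b ∈ Metric.ball c r := by
  rw [mem_ball_iff_norm]
  by_contra! hle
  have hpos : 0 < ‖b - c‖ := hr.trans_le hle
  set t := r / ‖b - c‖ with ht
  have ht0 : 0 < t := by positivity
  have ht1 : t ≤ 1 := (div_le_one hpos).2 hle
  have hconv := hF.2 (Set.mem_univ c) (Set.mem_univ b) (sub_nonneg.2 ht1) ht0.le (by ring)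
  have hsphere : (1 - t) • c + t • b ∈ Metric.sphere c r := by
    have : (1 - t) • c + t • b - c = t • (b - c) := by module
    rw [mem_sphere_iff_norm, this, norm_smul, Real.norm_of_nonneg ht0.le, ht]
    field_simp
  have hlt := hs _ hsphere
  simp only [smul_eq_mul] at hconv
  nlinarith

theorem exists_forall_le_of_convexOn_of_lt_on_sphere [ProperSpace E] (hF : ConvexOn ℝ Set.univ F)
    (hc : Continuous F) (hr : 0 < r) (hs : ∀ u ∈ Metric.sphere c r, F c < F u) :
    ∃ b, ∀ u, F b ≤ F u := by
  refine hc.exists_forall_le' c ?_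
  filter_upwards [(isCompact_closedBall c r).compl_mem_cocompact] with u hu
  by_contra! hlt
  exact hu (Metric.ball_subset_closedBall
    (mem_ball_of_convexOn_of_lt_on_sphere hF hr hs hlt.le))

end Convex

/-! ### Linear scores -/

section LinearScore

variable {p n : ℕ}

theorem abs_dotProduct_le (x b : Feature p) : |x ⬝ᵥ b| ≤ p * ‖x‖ * ‖b‖ := by
  calc |∑ i, x i * b i| ≤ ∑ i, |x i * b i| := Finset.abs_sum_le_sum_abs _ _
    _ ≤ ∑ _i : Fin p, ‖x‖ * ‖b‖ := Finset.sum_le_sum fun i _ => by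
        rw [abs_mul]
        exact mul_le_mul (norm_le_pi_norm x i) (norm_le_pi_norm b i) (abs_nonneg _)
          (norm_nonneg _)
    _ = p * ‖x‖ * ‖b‖ := by simp [mul_assoc]

theorem logisticProb_eq_sigmoid (β x : Feature p) :
    logisticProb β x = Real.sigmoid (x ⬝ᵥ β) := by
  rw [logisticProb, Real.sigmoid_def, one_div]

/-- The logistic loss of the linear score `x ↦ xᵀb` at the labelled sample `q = (x, z)`. -/
noncomputable def scoreLoss (b : Feature p) (q : Sample p) : ℝ :=
  logisticLoss (q.2 * (q.1 ⬝ᵥ b))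

theorem empLogisticRisk_linearScore (D : Dataset p n) (b : Feature p) :
    empLogisticRisk D (linearScore b) = 1 / (n : ℝ) * ∑ i, scoreLoss b (D i) := rfl

theorem continuous_scoreLoss :
    Continuous fun y : Feature p × Sample p => scoreLoss y.1 y.2 :=
  continuous_logisticLoss.comp (by unfold dotProduct; fun_prop)

theorem convexOn_scoreLoss (q : Sample p) :
    ConvexOn ℝ Set.univ fun b : Feature p => scoreLoss b q :=
  strictConvexOn_logisticLoss.convexOn.comp_linearMap (q.2 • dotProductBilin ℝ ℝ q.1)

theorem abs_scoreLoss_sub_le {q : Sample p} (hq : |q.2| = 1) (b b' : Feature p) :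
    |scoreLoss b q - scoreLoss b' q| ≤ p * ‖q.1‖ * ‖b - b'‖ := by
  refine (abs_logisticLoss_sub_le _ _).trans ?_
  rw [← mul_sub, ← dotProduct_sub, abs_mul, hq, one_mul]
  exact abs_dotProduct_le _ _

theorem abs_scoreLoss_le {q : Sample p} (hq : |q.2| = 1) (b : Feature p) :
    |scoreLoss b q| ≤ Real.log 2 + p * ‖q.1‖ * ‖b‖ := by
  refine (abs_logisticLoss_le _).trans ?_
  rw [abs_mul, hq, one_mul]
  gcongr
  exact abs_dotProduct_le _ _

theorem continuous_empLogisticRisk_linearScore :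
    Continuous fun y : Dataset p n × Feature p => empLogisticRisk y.1 (linearScore y.2) := by
  simp only [empLogisticRisk_linearScore]
  exact continuous_const.mul (continuous_finsetSum _ fun i _ =>
    continuous_scoreLoss.comp (f := fun y : Dataset p n × Feature p => (y.2, y.1 i)) (by fun_prop))

theorem convexOn_empLogisticRisk (D : Dataset p n) :
    ConvexOn ℝ Set.univ fun b : Feature p => empLogisticRisk D (linearScore b) := by
  have hsum : ConvexOn ℝ Set.univ (∑ i, fun b : Feature p => scoreLoss b (D i)) :=
    Finset.sum_induction _ (ConvexOn ℝ Set.univ) (fun _ _ => ConvexOn.add)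
      (convexOn_const 0 convex_univ) fun i _ => convexOn_scoreLoss (D i)
  simpa [empLogisticRisk_linearScore] using hsum.smul (by positivity : 0 ≤ 1 / (n : ℝ))

theorem linearScore_mem_boundedLinearClass {β : Feature p} {B : ℝ} (h : ‖β‖ ≤ B) :
    linearScore β ∈ boundedLinearClass p B :=
  ⟨β, fun i => abs_le.1 ((norm_le_pi_norm β i).trans h), rfl⟩

/-- The data sets whose empirical logistic risk is larger on the sphere of radius `r` around `c`
than at `c`. By convexity all empirical risk minimizers then lie within distance `r` of `c`. -/
def localizingDatasets (n : ℕ) (c : Feature p) (r : ℝ) : Set (Dataset p n) :=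
  {D | ∀ u ∈ Metric.sphere c r,
    empLogisticRisk D (linearScore c) < empLogisticRisk D (linearScore u)}

theorem isOpen_localizingDatasets (n : ℕ) (c : Feature p) (r : ℝ) :
    IsOpen (localizingDatasets n c r) := by
  refine isOpen_iff_eventually.2 fun D hD => ?_
  refine (isCompact_sphere c r).eventually_forall_of_forall_eventually fun u hu => ?_
  refine Tendsto.eventually_lt ?_ continuous_empLogisticRisk_linearScore.continuousAt (hD u hu)
  exact (continuous_empLogisticRisk_linearScore.comp
    (f := fun y : Dataset p n × Feature p => (y.1, c)) (by fun_prop)).continuousAt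

variable {D : Dataset p n} {c : Feature p} {r : ℝ}

theorem exists_isLogisticMLE (hr : 0 < r) (hD : D ∈ localizingDatasets n c r) :
    ∃ β, IsLogisticMLE D β :=
  exists_forall_le_of_convexOn_of_lt_on_sphere (convexOn_empLogisticRisk D)
    (continuous_empLogisticRisk_linearScore.comp (by fun_prop : Continuous fun b => (D, b))) hr hD

theorem IsLogisticMLE.mem_ball {β : Feature p} (h : IsLogisticMLE D β) (hr : 0 < r)
    (hD : D ∈ localizingDatasets n c r) : β ∈ Metric.ball c r :=
  mem_ball_of_convexOn_of_lt_on_sphere (convexOn_empLogisticRisk D) hr hD (h c)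

theorem IsLogisticERM.exists_mem_ball {B : ℝ} {g : Feature p → ℝ}
    (h : IsLogisticERM (boundedLinearClass p B) D g) (hc : ‖c‖ ≤ B) (hr : 0 < r)
    (hD : D ∈ localizingDatasets n c r) : ∃ b ∈ Metric.ball c r, g = linearScore b := by
  obtain ⟨b, -, rfl⟩ := h.1
  exact ⟨b, mem_ball_of_convexOn_of_lt_on_sphere (convexOn_empLogisticRisk D) hr hD
    (h.2 _ (linearScore_mem_boundedLinearClass hc)), rfl⟩

end LinearScore

/-! ### Integration against the logistic law -/

section LogisticLaw

variable {p : ℕ} {ν : Measure (Feature p)} {β : Feature p}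

theorem measurable_logisticProb_right (β : Feature p) : Measurable (logisticProb β) := by
  unfold logisticProb dotProduct
  fun_prop

theorem measurePreserving_fst_logisticLaw (ν : Measure (Feature p)) (β : Feature p) :
    MeasurePreserving Prod.fst (logisticLaw ν β) ν := by
  refine ⟨measurable_fst, ?_⟩
  have hη : Measurable fun x => ENNReal.ofReal (logisticProb β x) :=
    (measurable_logisticProb_right β).ennreal_ofReal
  have hsum : ((fun x => ENNReal.ofReal (logisticProb β x)) +
      fun x => ENNReal.ofReal (1 - logisticProb β x)) = 1 := by
    ext x
    simp [← ENNReal.ofReal_add (logisticProb_pos β x).le (sub_nonneg.2 (logisticProb_le_one β x))]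
  rw [logisticLaw, Measure.map_add _ _ measurable_fst,
    Measure.map_map measurable_fst (by fun_prop), Measure.map_map measurable_fst (by fun_prop)]
  simp only [Function.comp_def, Measure.map_id']
  rw [← withDensity_add_left hη, hsum, withDensity_one]

theorem ae_logisticLaw_of_ae {P : Feature p → Prop} (h : ∀ᵐ x ∂ν, P x) :
    ∀ᵐ q ∂logisticLaw ν β, P q.1 :=
  (measurePreserving_fst_logisticLaw ν β).quasiMeasurePreserving.ae h

theorem ae_abs_label_eq_one (ν : Measure (Feature p)) (β : Feature p) :
    ∀ᵐ q ∂logisticLaw ν β, |q.2| = 1 := by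
  have hmeas : MeasurableSet {q : Sample p | |q.2| = 1} :=
    measurableSet_eq_fun (by fun_prop) measurable_const
  rw [logisticLaw, ae_add_measure_iff, ae_map_iff (by fun_prop) hmeas,
    ae_map_iff (by fun_prop) hmeas]
  simp

theorem integral_logisticLaw {φ : Sample p → ℝ} (hφ : Integrable φ (logisticLaw ν β)) :
    ∫ q, φ q ∂logisticLaw ν β =
      ∫ x, (logisticProb β x * φ (x, 1) + (1 - logisticProb β x) * φ (x, -1)) ∂ν := by
  have hη := measurable_logisticProb_right β
  have hη' : Measurable fun x => 1 - logisticProb β x := measurable_const.sub hη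
  have hpos : ∀ x, (ENNReal.ofReal (logisticProb β x)).toReal = logisticProb β x :=
    fun x => ENNReal.toReal_ofReal (logisticProb_pos β x).le
  have hneg : ∀ x, (ENNReal.ofReal (1 - logisticProb β x)).toReal = 1 - logisticProb β x :=
    fun x => ENNReal.toReal_ofReal (sub_nonneg.2 (logisticProb_le_one β x))
  obtain ⟨h₁, h₂⟩ := integrable_add_measure.1 hφ
  rw [logisticLaw, integral_add_measure h₁ h₂,
    (measurableEmbedding_prod_mk_right _).integral_map,
    (measurableEmbedding_prod_mk_right _).integral_map,
    integral_withDensity_eq_integral_toReal_smul hη.ennreal_ofReal (by simp),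
    integral_withDensity_eq_integral_toReal_smul hη'.ennreal_ofReal (by simp)]
  rw [(measurableEmbedding_prod_mk_right _).integrable_map_iff,
    integrable_withDensity_iff_integrable_smul' (by fun_prop) (by simp)] at h₁ h₂
  simp only [Function.comp_apply, hpos, hneg, smul_eq_mul] at h₁ h₂ ⊢
  exact (integral_add h₁ h₂).symm

theorem aestronglyMeasurable_scoreLoss (Q : Measure (Sample p)) (b : Feature p) :
    AEStronglyMeasurable (scoreLoss b) Q :=
  (continuous_scoreLoss.comp (by fun_prop : Continuous fun q => (b, q))).aestronglyMeasurable

theorem integrable_scoreLoss [IsProbabilityMeasure ν] (hν : Integrable id ν) (β b : Feature p) :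
    Integrable (scoreLoss b) (logisticLaw ν β) := by
  have hx : Integrable (fun q => ‖q.1‖) (logisticLaw ν β) :=
    (measurePreserving_fst_logisticLaw ν β).integrable_comp_of_integrable hν.norm
  exact ((integrable_const (Real.log 2)).add ((hx.const_mul (p : ℝ)).mul_const ‖b‖)).mono'
    (aestronglyMeasurable_scoreLoss _ b)
    ((ae_abs_label_eq_one ν β).mono fun q hq => abs_scoreLoss_le hq b)

theorem hasLipschitzEnvelope_scoreLoss [IsProbabilityMeasure ν] (hν : MemLp id 2 ν)
    (β : Feature p) {K : Set (Feature p)} {R : ℝ} (hK : ∀ b ∈ K, ‖b‖ ≤ R) :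
    HasLipschitzEnvelope (logisticLaw ν β) K scoreLoss
      fun q => Real.log 2 + p * ‖q.1‖ * (R + 1) where
  memLp := (memLp_const (Real.log 2)).add
    (((hν.norm.comp_measurePreserving (measurePreserving_fst_logisticLaw ν β)).const_mul
      (p : ℝ)).mul_const (R + 1))
  aestronglyMeasurable b _ := aestronglyMeasurable_scoreLoss _ b
  abs_le := by
    filter_upwards [ae_abs_label_eq_one ν β] with q hq b hb
    refine (abs_scoreLoss_le hq b).trans ?_
    gcongr
    linarith [hK b hb]
  abs_sub_le := by
    filter_upwards [ae_abs_label_eq_one ν β] with q hq b hb b' _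
    refine (abs_scoreLoss_sub_le hq b b').trans ?_
    rw [dist_eq_norm]
    gcongr
    have hR : 0 ≤ R := (norm_nonneg b).trans (hK b hb)
    nlinarith [Real.log_pos one_lt_two, mul_nonneg (mul_nonneg p.cast_nonneg (norm_nonneg q.1)) hR]

end LogisticLaw

/-! ### The population logistic risk -/

section PopulationRisk

variable {p : ℕ} {ν : Measure (Feature p)}

/-- The logistic risk of the score `x ↦ xᵀb` when the features have law `ν` and the labels follow
the logistic model with coefficient `β`. -/
noncomputable def logisticRisk (ν : Measure (Feature p)) (β b : Feature p) : ℝ :=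
  ∫ q, scoreLoss b q ∂logisticLaw ν β

/-- The expected logistic loss of the score `x ↦ xᵀb` at the feature `x`, when the label follows
the logistic model with coefficient `β`, simplified by `logisticLoss_neg`. -/
noncomputable def condLogisticRisk (β b x : Feature p) : ℝ :=
  logisticLoss (x ⬝ᵥ b) + (1 - logisticProb β x) * (x ⬝ᵥ b)

theorem condLogisticRisk_eq (β b x : Feature p) : condLogisticRisk β b x =
    logisticProb β x * scoreLoss b (x, 1) + (1 - logisticProb β x) * scoreLoss b (x, -1) := by
  simp only [condLogisticRisk, scoreLoss, one_mul, neg_one_mul, logisticLoss_neg]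
  ring

theorem condLogisticRisk_self_lt {c b x : Feature p} (h : x ⬝ᵥ (b - c) ≠ 0) :
    condLogisticRisk c c x < condLogisticRisk c b x := by
  rw [dotProduct_sub, sub_ne_zero] at h
  have := logisticLoss_tangent_lt h.symm
  rw [Real.sigmoid_neg, ← logisticProb_eq_sigmoid] at this
  simp only [condLogisticRisk]
  linarith

theorem continuous_condLogisticRisk :
    Continuous fun y : (Feature p × Feature p) × Feature p =>
      condLogisticRisk y.1.1 y.1.2 y.2 := by
  simp only [condLogisticRisk, logisticProb_eq_sigmoid, dotProduct]
  exact (continuous_logisticLoss.comp (by fun_prop)).add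
    ((continuous_const.sub (continuous_sigmoid.comp (by fun_prop))).mul (by fun_prop))

theorem abs_condLogisticRisk_le (β b x : Feature p) :
    |condLogisticRisk β b x| ≤ Real.log 2 + 2 * (p * ‖x‖ * ‖b‖) := by
  have hdot := abs_dotProduct_le x b
  have hη : |(1 - logisticProb β x) * (x ⬝ᵥ b)| ≤ |x ⬝ᵥ b| := by
    rw [abs_mul, abs_of_nonneg (sub_nonneg.2 (logisticProb_le_one β x))]
    exact mul_le_of_le_one_left (abs_nonneg _) (by linarith [logisticProb_pos β x])
  have := abs_add_le (logisticLoss (x ⬝ᵥ b)) ((1 - logisticProb β x) * (x ⬝ᵥ b))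
  rw [condLogisticRisk]
  linarith [abs_logisticLoss_le (x ⬝ᵥ b)]

theorem integrable_condLogisticRisk [IsFiniteMeasure ν] (hν : Integrable id ν) (β b : Feature p) :
    Integrable (condLogisticRisk β b) ν := by
  refine Integrable.mono' (g := fun x => Real.log 2 + 2 * (p * ‖x‖ * ‖b‖))
    ((integrable_const _).add ((hν.norm.const_mul (p : ℝ)).mul_const ‖b‖ |>.const_mul 2)) ?_
    (ae_of_all _ fun x => abs_condLogisticRisk_le β b x)
  exact (continuous_condLogisticRisk.comp
    (by fun_prop : Continuous fun x => ((β, b), x))).aestronglyMeasurable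

theorem logisticRisk_eq_integral [IsProbabilityMeasure ν] (hν : Integrable id ν) (β b : Feature p) :
    logisticRisk ν β b = ∫ x, condLogisticRisk β b x ∂ν := by
  rw [logisticRisk, integral_logisticLaw (integrable_scoreLoss hν β b)]
  simp only [condLogisticRisk_eq]

theorem continuous_logisticRisk [IsProbabilityMeasure ν] (hν : Integrable id ν) :
    Continuous fun y : Feature p × Feature p => logisticRisk ν y.1 y.2 := by
  simp only [logisticRisk_eq_integral hν]
  refine continuous_iff_continuousAt.2 fun y₀ => continuousAt_of_dominated
    (bound := fun x => Real.log 2 + 2 * (p * ‖x‖ * (‖y₀.2‖ + 1)))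
    (Eventually.of_forall fun y => (integrable_condLogisticRisk hν y.1 y.2).aestronglyMeasurable)
    ?_ ?_ (ae_of_all _ fun x => ?_)
  · have hnorm : ∀ᶠ y : Feature p × Feature p in 𝓝 y₀, ‖y.2‖ < ‖y₀.2‖ + 1 :=
      continuous_snd.norm.continuousAt.eventually_lt_const (lt_add_one _)
    filter_upwards [hnorm] with y hy
    refine ae_of_all _ fun x => (abs_condLogisticRisk_le y.1 y.2 x).trans ?_
    gcongr
  · exact (integrable_const (Real.log 2)).add
      (((hν.norm.const_mul (p : ℝ)).mul_const _).const_mul 2)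
  · exact (continuous_condLogisticRisk.comp
      (by fun_prop : Continuous fun y : Feature p × Feature p => (y, x))).continuousAt

theorem volume_setOf_dotProduct_eq_zero {b : Feature p} (hb : b ≠ 0) :
    (volume : Measure (Feature p)) {x | x ⬝ᵥ b = 0} = 0 := by
  refine Measure.addHaar_submodule volume (LinearMap.ker ((dotProductBilin ℝ ℝ).flip b))
    fun h => hb ?_
  have hself : b ∈ LinearMap.ker ((dotProductBilin ℝ ℝ).flip b) := h ▸ Submodule.mem_top
  exact dotProduct_self_eq_zero.1 hself

theorem ae_dotProduct_ne_zero (hν : ν ≪ volume) {b : Feature p} (hb : b ≠ 0) :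
    ∀ᵐ x ∂ν, x ⬝ᵥ b ≠ 0 :=
  ae_iff.2 (by simpa using hν (volume_setOf_dotProduct_eq_zero hb))

theorem logisticRisk_self_lt [IsProbabilityMeasure ν] (hν : ν ≪ volume) (hint : Integrable id ν)
    {c b : Feature p} (hbc : b ≠ c) : logisticRisk ν c c < logisticRisk ν c b := by
  have hlt : ∀ᵐ x ∂ν, condLogisticRisk c c x < condLogisticRisk c b x :=
    (ae_dotProduct_ne_zero hν (sub_ne_zero.2 hbc)).mono fun x => condLogisticRisk_self_lt
  have hle : condLogisticRisk c c ≤ᵐ[ν] condLogisticRisk c b := hlt.mono fun x => le_of_lt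
  have hc := integrable_condLogisticRisk hint c c
  have hb := integrable_condLogisticRisk hint c b
  rw [logisticRisk_eq_integral hint, logisticRisk_eq_integral hint]
  refine (integral_mono_ae hc hb hle).lt_of_ne fun heq => ?_
  obtain ⟨x, hx, hx'⟩ := (hlt.and ((integral_eq_iff_of_ae_le hc hb hle).1 heq)).exists
  exact hx.ne hx'

theorem exists_eventually_logisticRisk_add_lt [IsProbabilityMeasure ν] (hν : ν ≪ volume)
    (hint : Integrable id ν) (c : Feature p) {r : ℝ} (hr : 0 < r) :
    ∃ ε > 0, ∀ᶠ β in 𝓝 c, ∀ u ∈ Metric.sphere c r,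
      logisticRisk ν β c + ε < logisticRisk ν β u := by
  have hgap : Continuous fun y : Feature p × Feature p =>
      logisticRisk ν y.1 y.2 - logisticRisk ν y.1 c :=
    (continuous_logisticRisk hint).sub ((continuous_logisticRisk hint).comp
      (by fun_prop : Continuous fun y : Feature p × Feature p => (y.1, c)))
  obtain ⟨ε, hε, hmin⟩ := (isCompact_sphere c r).exists_forall_le' (a := 0)
    (hgap.comp (by fun_prop : Continuous fun u : Feature p => (c, u))).continuousOn
    fun u hu => sub_pos.2 (logisticRisk_self_lt hν hint (Metric.ne_of_mem_sphere hu hr.ne'))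
  refine ⟨ε / 2, half_pos hε,
    (isCompact_sphere c r).eventually_forall_of_forall_eventually fun u hu => ?_⟩
  have hu' : ε / 2 < logisticRisk ν c u - logisticRisk ν c c :=
    (half_lt_self hε).trans_le (hmin u hu)
  filter_upwards [hgap.continuousAt.eventually_const_lt hu'] with y hy
  linarith

end PopulationRisk

/-! ### Localization of the logistic risk minimizers -/

section Localization

variable {p : ℕ} {ν : Measure (Feature p)}

theorem mem_localizingDatasets_of_abs_empDeviation_lt {n : ℕ} {D : Dataset p n} {β c : Feature p}
    {r ε : ℝ} (hr : 0 ≤ r) (hgap : ∀ u ∈ Metric.sphere c r, logisticRisk ν β c + ε <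
      logisticRisk ν β u) (hD : ∀ u ∈ Metric.closedBall c r,
      |empDeviation (logisticLaw ν β) (scoreLoss u) D| < ε / 2) :
    D ∈ localizingDatasets n c r := by
  intro u hu
  have hc := (abs_lt.1 (hD c (Metric.mem_closedBall_self hr))).2
  have hu' := (abs_lt.1 (hD u (Metric.sphere_subset_closedBall hu))).1
  rw [empDeviation, ← empLogisticRisk_linearScore] at hc hu'
  have := hgap u hu
  simp only [logisticRisk] at this
  linarith

theorem exists_eventually_iidLaw_compl_localizingDatasets_le [IsProbabilityMeasure ν]
    (hν : ν ≪ volume) (hν2 : MemLp id 2 ν) (c : Feature p) {r : ℝ} (hr : 0 < r) :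
    ∃ C : ℝ, ∀ᶠ β in 𝓝 c, ∀ n : ℕ, 0 < n →
      iidLaw (logisticLaw ν β) n (localizingDatasets n c r)ᶜ ≤ ENNReal.ofReal (C / n) := by
  obtain ⟨ε, hε, hgap⟩ :=
    exists_eventually_logisticRisk_add_lt hν (hν2.integrable one_le_two) c hr
  have hball : ∀ b ∈ Metric.closedBall c r, ‖b‖ ≤ ‖c‖ + r := fun b hb =>
    norm_le_norm_add_const_of_dist_le hb
  let G : Feature p → ℝ := fun x => Real.log 2 + p * ‖x‖ * (‖c‖ + r + 1)
  have hmoment : ∀ β, ∫ q, G q.1 ^ 2 ∂logisticLaw ν β = ∫ x, G x ^ 2 ∂ν := fun β => by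
    have hG : Continuous fun x => G x ^ 2 := by fun_prop
    have hmp := measurePreserving_fst_logisticLaw ν β
    conv_rhs => rw [← hmp.map_eq]
    exact (integral_map hmp.aemeasurable hG.aestronglyMeasurable).symm
  obtain ⟨C, hC⟩ := HasLipschitzEnvelope.exists_pi_le_abs_empDeviation_le
    (isCompact_closedBall c r).totallyBounded (scoreLoss (p := p))
    (integral_nonneg fun x => sq_nonneg (G x) : 0 ≤ ∫ x, G x ^ 2 ∂ν) (half_pos hε)
  refine ⟨C, hgap.mono fun β hβ n hn => (measure_mono fun D hD => ?_).trans
    (hC _ _ (hasLipschitzEnvelope_scoreLoss hν2 β hball) (hmoment β).le n hn)⟩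
  by_contra! hdev
  simp only [Set.mem_ofPred_eq, not_exists, not_and, not_le] at hdev
  exact hD (mem_localizingDatasets_of_abs_empDeviation_lt hr.le hβ hdev)

end Localization

/-! ### The 0-1 risk of linear classifiers -/

section ZeroOneRisk

variable {p : ℕ} {ν : Measure (Feature p)} [IsProbabilityMeasure ν]

theorem measurable_realSign : Measurable Real.sign :=
  Measurable.ite measurableSet_Iio measurable_const
    (Measurable.ite measurableSet_Ioi measurable_const measurable_const)

theorem eventually_realSign_eq {s : ℝ} (hs : s ≠ 0) : ∀ᶠ t in 𝓝 s, t.sign = s.sign := by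
  rcases hs.lt_or_gt with h | h
  · filter_upwards [Iio_mem_nhds h] with t ht
    rw [Real.sign_of_neg h, Real.sign_of_neg ht]
  · filter_upwards [Ioi_mem_nhds h] with t ht
    rw [Real.sign_of_pos h, Real.sign_of_pos ht]

theorem measurableSet_misclassified (b : Feature p) :
    MeasurableSet {q : Sample p | Real.sign (linearScore b q.1) ≠ q.2} := by
  have h : Measurable fun q : Sample p => Real.sign (linearScore b q.1) := by
    unfold linearScore dotProduct
    exact measurable_realSign.comp (by fun_prop)
  exact (measurableSet_eq_fun h measurable_snd).compl

theorem continuousAt_zeroOneRisk (hν : ν ≪ volume) (β : Feature p) {b : Feature p} (hb : b ≠ 0) :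
    ContinuousAt (fun u => zeroOneRisk (logisticLaw ν β) (linearScore u)) b := by
  refine (ENNReal.tendsto_toReal (measure_ne_top _ _)).comp
    (tendsto_measure_of_ae_tendsto_indicator _ (measurableSet_misclassified b)
      measurableSet_misclassified MeasurableSet.univ (measure_ne_top _ _)
      (Eventually.of_forall fun _ => Set.subset_univ _) ?_)
  filter_upwards [ae_logisticLaw_of_ae (ae_dotProduct_ne_zero hν hb)] with q hq
  have hdot : Continuous fun u : Feature p => q.1 ⬝ᵥ u := by fun_prop
  filter_upwards [hdot.continuousAt.eventually (eventually_realSign_eq hq)] with u hu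
  simp only [linearScore, hu]

theorem exists_forall_mem_ball_classUtility_lt (hν : ν ≪ volume) {β : Feature p} (hβ : β ≠ 0)
    {δ : ℝ} (hδ : 0 < δ) :
    ∃ r > 0, ∀ b ∈ Metric.ball β r, ∀ b' ∈ Metric.ball β r,
      classUtility (logisticLaw ν β) (linearScore b) (linearScore b') < δ := by
  obtain ⟨r, hr, hball⟩ :=
    Metric.continuousAt_iff.1 (continuousAt_zeroOneRisk hν β hβ) (δ / 2) (half_pos hδ)
  refine ⟨r, hr, fun b hb b' hb' => ?_⟩
  rw [classUtility, ← Real.dist_eq, ← add_halves δ]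
  exact (dist_triangle_right _ _ _).trans_lt (add_lt_add (hball hb) (hball hb'))

theorem zeroOneRisk_logisticLaw_zero (hν : ν ≪ volume) {b : Feature p} (hb : b ≠ 0) :
    zeroOneRisk (logisticLaw ν 0) (linearScore b) = 1 / 2 := by
  have hmeas := measurableSet_misclassified b
  rw [zeroOneRisk, ← integral_indicator_one hmeas,
    integral_logisticLaw (φ := Set.indicator _ 1) ((integrable_const (1 : ℝ)).indicator hmeas)]
  have hhalf : ∀ᵐ x ∂ν, logisticProb 0 x *
      {q : Sample p | Real.sign (linearScore b q.1) ≠ q.2}.indicator 1 (x, 1) +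
      (1 - logisticProb 0 x) *
      {q : Sample p | Real.sign (linearScore b q.1) ≠ q.2}.indicator 1 (x, -1) = (1 / 2 : ℝ) := by
    filter_upwards [ae_dotProduct_ne_zero hν hb] with x hx
    rcases hx.lt_or_gt with h | h
    · norm_num [Set.indicator, linearScore, logisticProb, Real.sign_of_neg h]
    · norm_num [Set.indicator, linearScore, logisticProb, Real.sign_of_pos h]
  rw [integral_congr_ae hhalf]
  simp

end ZeroOneRisk

/-! ### The zero classifier is almost surely not an empirical risk minimizer -/

section ZeroClassifier

variable {p n : ℕ}

theorem hasDerivAt_empLogisticRisk_smul (D : Dataset p n) (v : Feature p) :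
    HasDerivAt (fun t : ℝ => empLogisticRisk D (linearScore (t • v)))
      (1 / (n : ℝ) * ∑ i, -(1 / 2) * ((D i).2 * ((D i).1 ⬝ᵥ v))) 0 := by
  simp only [empLogisticRisk_linearScore, scoreLoss, dotProduct_smul, smul_eq_mul, mul_left_comm]
  refine (HasDerivAt.fun_sum fun i _ => ?_).const_mul _
  have hmargin := (hasDerivAt_id (0 : ℝ)).mul_const ((D i).2 * ((D i).1 ⬝ᵥ v))
  have hloss := hasDerivAt_logisticLoss (0 * ((D i).2 * ((D i).1 ⬝ᵥ v)))
  refine (hloss.comp 0 hmargin).congr_deriv ?_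
  rw [zero_mul, neg_zero, Real.sigmoid_zero]
  ring

theorem sum_mul_dotProduct_eq_zero_of_isLogisticERM_zero {B : ℝ} (hB : 0 < B) (hn : 0 < n)
    {D : Dataset p n} (h : IsLogisticERM (boundedLinearClass p B) D (linearScore 0))
    (v : Feature p) : ∑ i, (D i).2 * ((D i).1 ⬝ᵥ v) = 0 := by
  have hmin : IsLocalMin (fun t : ℝ => empLogisticRisk D (linearScore (t • v))) 0 := by
    have hsmall : ∀ᶠ t : ℝ in 𝓝 0, ‖t • v‖ < B :=
      (by fun_prop : Continuous fun t : ℝ => ‖t • v‖).continuousAt.eventually_lt_const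
        (by simpa using hB)
    filter_upwards [hsmall] with t ht
    rw [zero_smul]
    exact h.2 _ (linearScore_mem_boundedLinearClass ht.le)
  have hderiv := hmin.hasDerivAt_eq_zero (hasDerivAt_empLogisticRisk_smul D v)
  rw [← Finset.mul_sum] at hderiv
  simpa [hn.ne'] using hderiv

theorem pi_sum_eq_null {α E : Type*} [MeasurableSpace α] {Q : Measure α} [SigmaFinite Q]
    [AddCommGroup E] [MeasurableSpace E] [MeasurableAdd₂ E] [MeasurableSingletonClass E]
    {f : α → E} (hf : Measurable f) (hQ : ∀ a, Q {q | f q = a} = 0) (hn : 0 < n) (a : E) :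
    Measure.pi (fun _ : Fin n => Q) {D | ∑ i, f (D i) = a} = 0 := by
  obtain ⟨n, rfl⟩ := Nat.exists_eq_add_one_of_ne_zero hn.ne'
  let S : Set (α × (Fin n → α)) := {y | f y.1 + ∑ i, f (y.2 i) = a}
  have hS : MeasurableSet S :=
    (by fun_prop : Measurable fun y : α × (Fin n → α) => f y.1 + ∑ i, f (y.2 i))
      (measurableSet_singleton a)
  have hpre : {D : Fin (n + 1) → α | ∑ i, f (D i) = a} =
      MeasurableEquiv.piFinSuccAbove (fun _ => α) 0 ⁻¹' S := by
    ext D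
    simp [S, Fin.sum_univ_succ, Fin.tail]
  rw [hpre, (measurePreserving_piFinSuccAbove (fun _ => Q) 0).measure_preimage
    hS.nullMeasurableSet, Measure.prod_apply_symm hS]
  refine lintegral_eq_zero_of_ae_eq_zero (ae_of_all _ fun y => ?_)
  simpa [S, ← eq_sub_iff_add_eq] using hQ (a - ∑ i, f (y i))

theorem logisticLaw_mul_eq_null {ν : Measure (Feature p)} (hν : ν ≪ volume) (β : Feature p)
    (k : Fin p) (a : ℝ) : logisticLaw ν β {q | q.2 * q.1 k = a} = 0 := by
  have hne : ∀ a : ℝ, ∀ᵐ x ∂ν, x k ≠ a := fun a =>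
    ae_iff.2 (by simpa using hν (Measure.pi_hyperplane (fun _ : Fin p => volume) k a))
  refine measure_eq_zero_iff_ae_notMem.2 ?_
  filter_upwards [ae_abs_label_eq_one ν β, ae_logisticLaw_of_ae (hne a),
    ae_logisticLaw_of_ae (hne (-a))] with q hq hpos hneg
  rcases eq_or_eq_neg_of_abs_eq hq with h | h
  · simpa [h] using hpos
  · simpa [h, neg_eq_iff_eq_neg] using hneg

theorem ae_iidLaw_sum_mul_ne_zero {ν : Measure (Feature p)} [IsProbabilityMeasure ν]
    (hν : ν ≪ volume) (β : Feature p) (k : Fin p) (hn : 0 < n) :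
    ∀ᵐ D ∂iidLaw (logisticLaw ν β) n, ∑ i, (D i).2 * (D i).1 k ≠ 0 :=
  measure_eq_zero_iff_ae_notMem.1
    (pi_sum_eq_null (by fun_prop) (logisticLaw_mul_eq_null hν β k) hn 0)

theorem IsLogisticERM.zeroOneRisk_logisticLaw_zero {ν : Measure (Feature p)}
    [IsProbabilityMeasure ν] {D : Dataset p n} {g : Feature p → ℝ} {B : ℝ}
    (h : IsLogisticERM (boundedLinearClass p B) D g) (hν : ν ≪ volume) (hB : 0 < B) (hn : 0 < n)
    {k : Fin p} (hD : ∑ i, (D i).2 * (D i).1 k ≠ 0) :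
    zeroOneRisk (logisticLaw ν 0) g = 1 / 2 := by
  obtain ⟨b, -, rfl⟩ := h.1
  refine _root_.zeroOneRisk_logisticLaw_zero hν ?_
  rintro rfl
  exact hD (by simpa using
    sum_mul_dotProduct_eq_zero_of_isLogisticERM_zero hB hn h (Pi.single k 1))

end ZeroClassifier

/-! ### The utility gap -/

theorem compProd_le_add {α β : Type*} [MeasurableSpace α] [MeasurableSpace β] {μ : Measure α}
    [IsProbabilityMeasure μ] {κ : Kernel α β} [IsMarkovKernel κ] {A : Set α} {A' : Set β}
    (hA : MeasurableSet A) (hA' : MeasurableSet A') {a : ℝ≥0∞} (ha : ∀ x ∉ A, κ x A' ≤ a)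
    {s : Set (α × β)} (hs : ∀ ω ∈ s, ω.1 ∈ A ∨ ω.2 ∈ A') : (μ ⊗ₘ κ) s ≤ μ A + a := by
  have hsub : s ⊆ A ×ˢ Set.univ ∪ Aᶜ ×ˢ A' := fun ω hω => by
    by_cases h : ω.1 ∈ A
    · exact Or.inl ⟨h, trivial⟩
    · exact Or.inr ⟨h, (hs ω hω).resolve_left h⟩
  refine (measure_mono hsub).trans ((measure_union_le _ _).trans (add_le_add ?_ ?_))
  · rw [Measure.compProd_apply_prod hA MeasurableSet.univ]
    simp
  · calc (μ ⊗ₘ κ) (Aᶜ ×ˢ A') = ∫⁻ x in Aᶜ, κ x A' ∂μ :=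
          Measure.compProd_apply_prod hA.compl hA'
      _ ≤ ∫⁻ _ in Aᶜ, a ∂μ := setLIntegral_mono measurable_const ha
      _ ≤ a := by
          rw [setLIntegral_const]
          exact mul_le_of_le_one_right' prob_le_one

section UtilityGap

variable {p : ℕ} {μ ν : Measure (Feature p)} [IsProbabilityMeasure μ] [IsProbabilityMeasure ν]
  {B : ℝ}

/-- When the labels are fair coins the 0-1 risk is discontinuous at the zero classifier, but it is
constant on all other linear classifiers. -/
theorem ae_classUtility_eq_zero (hμ : μ ≪ volume) (hν : ν ≪ volume) (hB : 0 < B) {n m : ℕ}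
    (hn : 0 < n) (hm : 0 < m) {βhat : Dataset p n → Feature p} (hβmeas : Measurable βhat)
    {ghat : Dataset p n → Feature p → ℝ} {gtilde : Dataset p m → Feature p → ℝ}
    (hghat : ∀ D, IsLogisticERM (boundedLinearClass p B) D (ghat D))
    (hgtilde : ∀ D, IsLogisticERM (boundedLinearClass p B) D (gtilde D)) :
    ∀ᵐ ω ∂jointLaw μ ν 0 n m βhat hβmeas,
      classUtility (logisticLaw μ 0) (gtilde ω.2) (ghat ω.1) = 0 := by
  rcases isEmpty_or_nonempty (Fin p) with hp | ⟨⟨k⟩⟩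
  · refine ae_of_all _ fun ω => ?_
    obtain ⟨b, -, hb⟩ := (hghat ω.1).1
    obtain ⟨b', -, hb'⟩ := (hgtilde ω.2).1
    rw [hb, hb', Subsingleton.elim b b', classUtility, sub_self, abs_zero]
  · have hmeas : ∀ n, MeasurableSet {D : Dataset p n | ∑ i, (D i).2 * (D i).1 k ≠ 0} :=
      fun n => (measurableSet_eq_fun (by fun_prop) measurable_const).compl
    have horig : ∀ᵐ ω ∂jointLaw μ ν 0 n m βhat hβmeas, ∑ i, (ω.1 i).2 * (ω.1 i).1 k ≠ 0 :=
      Measure.ae_compProd_of_ae_fst _ (hmeas n) (ae_iidLaw_sum_mul_ne_zero hμ 0 k hn)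
    have hsynth : ∀ᵐ ω ∂jointLaw μ ν 0 n m βhat hβmeas, ∑ i, (ω.2 i).2 * (ω.2 i).1 k ≠ 0 :=
      Measure.ae_compProd_of_ae_ae (measurable_snd (hmeas m))
        (ae_of_all _ fun D => ae_iidLaw_sum_mul_ne_zero hν (βhat D) k hm)
    filter_upwards [horig, hsynth] with ω h h'
    rw [classUtility, (hghat ω.1).zeroOneRisk_logisticLaw_zero hμ hB hn h,
      (hgtilde ω.2).zeroOneRisk_logisticLaw_zero hμ hB hm h', sub_self, abs_zero]

theorem exists_jointLaw_lt_classUtility_le (hμ : μ ≪ volume) (hν : ν ≪ volume)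
    (hμ2 : MemLp id 2 μ) (hν2 : MemLp id 2 ν) {βstar : Feature p} (hne : βstar ≠ 0)
    (hB : ‖βstar‖ ≤ B) {βhat : ∀ n : ℕ, Dataset p n → Feature p}
    (hβmeas : ∀ n, Measurable (βhat n))
    (hβ : ∀ n D, (∃ β, IsLogisticMLE D β) → IsLogisticMLE D (βhat n D))
    {ghat gtilde : ∀ n : ℕ, Dataset p n → Feature p → ℝ}
    (hghat : ∀ n D, IsLogisticERM (boundedLinearClass p B) D (ghat n D))
    (hgtilde : ∀ n D, IsLogisticERM (boundedLinearClass p B) D (gtilde n D))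
    {δ : ℝ} (hδ : 0 < δ) :
    ∃ C C' : ℝ, ∀ n m, 0 < n → 0 < m →
      jointLaw μ ν βstar n m (βhat n) (hβmeas n)
          {ω | δ < classUtility (logisticLaw μ βstar) (gtilde m ω.2) (ghat n ω.1)} ≤
        ENNReal.ofReal (C / n) + ENNReal.ofReal (C' / m) := by
  obtain ⟨r, hr, hutility⟩ := exists_forall_mem_ball_classUtility_lt hμ hne hδ
  obtain ⟨C', hC'⟩ := exists_eventually_iidLaw_compl_localizingDatasets_le hν hν2 βstar hr
  obtain ⟨η, hη, hsynth⟩ := Metric.eventually_nhds_iff_ball.1 hC'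
  have hrη : 0 < min r η := lt_min hr hη
  obtain ⟨C, hC⟩ := exists_eventually_iidLaw_compl_localizingDatasets_le hμ hμ2 βstar hrη
  refine ⟨C, C', fun n m hn hm => (compProd_le_add
    (isOpen_localizingDatasets n βstar (min r η)).measurableSet.compl
    (isOpen_localizingDatasets m βstar r).measurableSet.compl (a := ENNReal.ofReal (C' / m))
    (fun D hD => ?_) fun ω hω => ?_).trans (add_le_add_left (hC.self_of_nhds n hn) _)⟩
  · have hD' : D ∈ localizingDatasets n βstar (min r η) := not_not.1 hD
    have hmle := (hβ n D (exists_isLogisticMLE hrη hD')).mem_ball hrη hD'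
    exact hsynth _ (Metric.ball_subset_ball (min_le_right _ _) hmle) m hm
  · by_contra! hloc
    simp only [Set.mem_compl_iff, not_not] at hloc
    obtain ⟨b, hb, hgb⟩ := (hghat n ω.1).exists_mem_ball hB hrη hloc.1
    obtain ⟨b', hb', hgb'⟩ := (hgtilde m ω.2).exists_mem_ball hB hr hloc.2
    rw [Set.mem_ofPred_eq, hgb, hgb'] at hω
    exact hω.not_gt (hutility b' hb' b (Metric.ball_subset_ball (min_le_left _ _) hb))

theorem theoremS1_general (hμ : μ ≪ volume) (hν : ν ≪ volume) (hμ2 : MemLp id 2 μ)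
    (hν2 : MemLp id 2 ν) {βstar : Feature p} (hB : ‖βstar‖ < B)
    {βhat : ∀ n : ℕ, Dataset p n → Feature p} (hβmeas : ∀ n, Measurable (βhat n))
    (hβ : ∀ n D, (∃ β, IsLogisticMLE D β) → IsLogisticMLE D (βhat n D))
    {ghat gtilde : ∀ n : ℕ, Dataset p n → Feature p → ℝ}
    (hghat : ∀ n D, IsLogisticERM (boundedLinearClass p B) D (ghat n D))
    (hgtilde : ∀ n D, IsLogisticERM (boundedLinearClass p B) D (gtilde n D))
    {δ : ℝ} (hδ : 0 < δ) :
    ∃ C C' : ℝ, ∀ n m, 0 < n → 0 < m →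
      jointLaw μ ν βstar n m (βhat n) (hβmeas n)
          {ω | δ < classUtility (logisticLaw μ βstar) (gtilde m ω.2) (ghat n ω.1)} ≤
        ENNReal.ofReal (C / n) + ENNReal.ofReal (C' / m) := by
  rcases eq_or_ne βstar 0 with rfl | hne
  · refine ⟨0, 0, fun n m hn hm => ?_⟩
    have hzero := ae_classUtility_eq_zero hμ hν ((norm_nonneg _).trans_lt hB) hn hm (hβmeas n)
      (hghat n) (hgtilde m)
    have hnull := measure_eq_zero_iff_ae_notMem.2 (hzero.mono fun ω hω => (hω.trans_lt hδ).not_gt)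
    exact hnull.le.trans zero_le
  · exact exists_jointLaw_lt_classUtility_le hμ hν hμ2 hν2 hne hB.le hβmeas hβ hghat hgtilde hδ

end UtilityGap

theorem HasDensityOn.absolutelyContinuous {p : ℕ} {μ : Measure (Feature p)}
    {𝒳 : Set (Feature p)} {f : Feature p → ℝ} (h : HasDensityOn μ 𝒳 f) : μ ≪ volume :=
  h.eq_withDensity ▸ withDensity_absolutelyContinuous _ _

theorem HasDensityOn.ae_mem {p : ℕ} {μ : Measure (Feature p)} {𝒳 : Set (Feature p)}
    {f : Feature p → ℝ} (h : HasDensityOn μ 𝒳 f) : ∀ᵐ x ∂μ, x ∈ 𝒳 := by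
  rw [h.eq_withDensity, ae_withDensity_iff h.measurable.ennreal_ofReal]
  refine ae_of_all _ fun x hx => ?_
  by_contra hx'
  exact hx (by rw [h.eq_zero_of_notMem x hx', ENNReal.ofReal_zero])

theorem HasDensityOn.memLp_id {p : ℕ} {μ : Measure (Feature p)} [IsFiniteMeasure μ]
    {𝒳 : Set (Feature p)} {f : Feature p → ℝ} (h : HasDensityOn μ 𝒳 f)
    (h𝒳 : Bornology.IsBounded 𝒳) (q : ℝ≥0∞) : MemLp id q μ := by
  obtain ⟨M, hM⟩ := h𝒳.exists_norm_le
  exact MemLp.of_bound aestronglyMeasurable_id M (h.ae_mem.mono hM)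

theorem tendsto_limsup_zero_of_le {f : ℕ → ℕ → ℝ≥0∞} {C C' : ℝ}
    (h : ∀ n m, 0 < n → 0 < m → f n m ≤ ENNReal.ofReal (C / n) + ENNReal.ofReal (C' / m)) :
    Tendsto (fun n => limsup (f n) atTop) atTop (𝓝 0) := by
  have hzero : ∀ C : ℝ, Tendsto (fun n : ℕ => ENNReal.ofReal (C / n)) atTop (𝓝 0) := fun C => by
    simpa using ENNReal.tendsto_ofReal (tendsto_const_div_atTop_nhds_zero_nat C)
  refine tendsto_of_tendsto_of_tendsto_of_le_of_le' tendsto_const_nhds (hzero C)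
    (Eventually.of_forall fun _ => zero_le) ?_
  filter_upwards [eventually_gt_atTop 0] with n hn
  have hlim := (hzero C').const_add (ENNReal.ofReal (C / n))
  rw [add_zero] at hlim
  rw [← hlim.limsup_eq]
  refine limsup_le_limsup ?_
  filter_upwards [eventually_gt_atTop 0] with m hm using h n m hn hm

theorem theoremS1 (p : ℕ) (𝒳 : Set (Feature p)) (h𝒳 : IsCompact 𝒳)
    -- laws of the original and of the synthetic features, with densities on `𝒳`
    (PX PXt : Measure (Feature p)) [IsProbabilityMeasure PX] [IsProbabilityMeasure PXt]
    (fX fXt : Feature p → ℝ) (hX : HasDensityOn PX 𝒳 fX) (hXt : HasDensityOn PXt 𝒳 fXt)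
    (C₁ : ℝ) (hC₁ : 0 < C₁) (hratio : ∀ x ∈ 𝒳, fXt x ≤ C₁ * fX x)
    (βstar : Feature p) (B : ℝ) (hB : ‖βstar‖ < B / 2)
    -- the maximum likelihood estimator (arbitrary on data sets for which none exists)
    (βhat : ∀ n : ℕ, Dataset p n → Feature p) (hβmeas : ∀ n, Measurable (βhat n))
    (hβ : ∀ n D, (∃ β, IsLogisticMLE D β) → IsLogisticMLE D (βhat n D))
    -- the downstream classifiers fitted on the original and on the synthetic data
    (ghat gtilde : ∀ n : ℕ, Dataset p n → Feature p → ℝ)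
    (hghat_meas : ∀ n, Measurable (ghat n)) (hgtilde_meas : ∀ n, Measurable (gtilde n))
    (hghat : ∀ n D, IsLogisticERM (boundedLinearClass p B) D (ghat n D))
    (hgtilde : ∀ n D, IsLogisticERM (boundedLinearClass p B) D (gtilde n D))
    (δ : ℝ) (hδ : 0 < δ) :
    Tendsto
      (fun n : ℕ =>
        limsup
          (fun m : ℕ =>
            jointLaw PX PXt βstar n m (βhat n) (hβmeas n)
              {ω | δ < classUtility (logisticLaw PX βstar) (gtilde m ω.2) (ghat n ω.1)})
          atTop)
      atTop (𝓝 0) := by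
  obtain ⟨C, C', h⟩ := theoremS1_general hX.absolutelyContinuous hXt.absolutelyContinuous
    (hX.memLp_id h𝒳.isBounded 2) (hXt.memLp_id h𝒳.isBounded 2)
    (hB.trans (half_lt_self (by linarith [norm_nonneg βstar]))) hβmeas hβ hghat hgtilde hδ
  exact tendsto_limsup_zero_of_le h
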